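/- A linear relation in a complex Hilbert space $\mathfrak H$ is a linear subspace $T\subset\mathfrak H\times\mathfrak H$, with adjoint $T^*=\{\{h,k\}:(k,f)=(h,g)\text{ for all }\{f,g\}\in T\}$; it is symmetric if $T\subset T^*$ and selfadjoint if $T=T^*$. Its resolvent set $\rho(T)$ consists of all $\lambda\in\mathbb C$ for which $(T-\lambda)^{-1}=\{\{f'-\lambda f,f\}:\{f,f'\}\in T\}$ is an everywhere defined bounded operator. Write $\widehat f=\{f,f'\}$ and $\widehat f_1\oplus\widehat f_2=\{f_1\oplus f_2,f_1'\oplus f_2'\}$. A symmetric relation $S$ in $\mathfrak H$ is simple if there is no closed subspace $\mathfrak K\ne\{0\}$ of $\mathfrak H$ such that $S=S'\oplus S''$ with $S'$ symmetric in $\mathfrak K^\perp$ and $S''$ selfadjoint in $\mathfrak K$. Let $\mathfrak H,\mathcal H$ be Hilbert spaces and $S$ a closed symmetric relation in $\mathfrak H$. A linear relation $\Gamma\subset\mathfrak H^2\times\mathcal H^2$ is a boundary relation for $S^*$ if $T=\operatorname{dom}\Gamma$ is a dense subset of $S^*$, the identity $$(f',g)-(f,g')=(h',k)-(h,k')$$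 holds for all $\{\widehat f,\widehat h\},\{\widehat g,\widehat k\}\in\Gamma$, and every $\{\widehat g,\widehat k\}\in\mathfrak H^2\times\mathcal H^2$ satisfying this identity for all $\{\widehat f,\widehat h\}\in\Gamma$ belongs to $\Gamma$. It is minimal if $\mathfrak H=\overline{\operatorname{span}}\{\ker(T-\lambda):\lambda\in\mathbb C\setminus\mathbb R\}$. **Theorem.** Let $\mathfrak H_1,\mathfrak H_2,\mathcal H$ be complex Hilbert spaces, let $A$ be a symmetric linear relation in $\mathfrak H_1$ (for example a symmetric operator, not necessarily densely defined), and let $\Pi=\{\mathcal H,\Gamma_0,\Gamma_1\}$ be an ordinary boundary triplet for $A^*$: $\Gamma_0,\Gamma_1:A^*\to\mathcal H$ are linear, $\{\Gamma_0,\Gamma_1\}:A^*\to\mathcal H^2$ is surjective, and $(f',g)-(f,g')=(\Gamma_1\widehat f,\Gamma_0\widehat g)-(\Gamma_0\widehat f,\Gamma_1\widehat g)$ for all $\widehat f,\widehat g\in A^*$. (It is then automatic that $A$ has equal defect numbers, both equal to $\dim\mathcal H$.) (i) Let $\widetilde A=\widetilde A^*$ be a selfadjoint relation in $\mathfrak H_1\oplus\mathfrak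 H_2$ that extends $A$ and is minimal with respect to $\mathfrak H_1$, i.e. $\mathfrak H_1\oplus\mathfrak H_2=\overline{\operatorname{span}}\{\mathfrak H_1+(\widetilde A-\lambda)^{-1}\mathfrak H_1:\lambda\in\rho(\widetilde A)\}$. Put $S_2=\widetilde A\cap\mathfrak H_2^2$ and let $T_2$ be the relation in $\mathfrak H_2$ of all $\{P_2\varphi,P_2\varphi'\}$ with $\{\varphi,\varphi'\}\in\widetilde A$, where $P_2$ is the orthogonal projection onto $\mathfrak H_2$. Then $S_2$ is closed and symmetric, and $$\chi=\{\{\widehat f_2,\{\Gamma_0\widehat f_1,-\Gamma_1\widehat f_1\}\}:\widehat f_1\oplus\widehat f_2\in\widetilde A,\ \widehat f_1\in A^*,\ \widehat f_2\in T_2\}$$ is a minimal boundary relation for $S_2^*$. (ii) Conversely, let $S_2$ be a simple closed symmetric relation in $\mathfrak H_2$ (it is then necessarily an operator) and let $\chi\subset\mathfrak H_2^2\times\mathcal H^2$ be a minimal boundary relation for $S_2^*$. Then $$\widetilde A=\{\widehat f_1\oplus\widehat f_2:\widehat f_1\in A^*,\ \widehat f_2\in S_2^*,\ \{\widehat f_2,\{\Gamma_0\widehat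 f_1,-\Gamma_1\widehat f_1\}\}\in\chi\}$$ is a selfadjoint extension of $A$ in $\mathfrak H_1\oplus\mathfrak H_2$, it is minimal with respect to $\mathfrak H_1$, and $\widetilde A\cap\mathfrak H_2^2=S_2$. -/

import Mathlib

/-! Linear relations are linear subspaces of `E × F`; the adjoint of a relation is
`Submodule.adjoint`.  Mathlib's `inner ℂ x y` is linear in `y`, so the inner product `(x, y)` that is
linear in its first entry is `inner ℂ y x`. -/

noncomputable section

namespace LinRel

section Relations

variable {E : Type*} [NormedAddCommGroup E] [InnerProductSpace ℂ E]

/-- A relation `T` is symmetric if `T ⊆ T*`. -/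
def IsSymmetric (T : Submodule ℂ (E × E)) : Prop := T ≤ T.adjoint

/-- A relation `T` is selfadjoint if `T* = T`. -/
def IsSelfadjoint (T : Submodule ℂ (E × E)) : Prop := T.adjoint = T

/-- The orthogonal sum `S₁ ⊕ S₂` in `E = Kᗮ ⊕ K` of a relation `S₁` in `Kᗮ` and a relation `S₂`
in `K`. -/
def orthogonalSum (K : Submodule ℂ E) (S₁ : Submodule ℂ (Kᗮ × Kᗮ)) (S₂ : Submodule ℂ (K × K)) :
    Submodule ℂ (E × E) :=
  S₁.map (Kᗮ.subtype.prodMap Kᗮ.subtype) ⊔ S₂.map (K.subtype.prodMap K.subtype)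

/-- A symmetric relation is simple if it has no orthogonal decomposition into a symmetric relation
and a selfadjoint relation in a nonzero closed subspace. -/
def IsSimple (S : Submodule ℂ (E × E)) : Prop :=
  IsSymmetric S ∧
    ∀ K : Submodule ℂ E, IsClosed (K : Set E) →
      ∀ (S₁ : Submodule ℂ (Kᗮ × Kᗮ)) (S₂ : Submodule ℂ (K × K)),
        IsSymmetric S₁ → IsSelfadjoint S₂ → S = orthogonalSum K S₁ S₂ → K = ⊥

/-- The eigenspace `ker (T - z) = {f | (f, z f) ∈ T}`. -/
def eigenspace (T : Submodule ℂ (E × E)) (z : ℂ) : Submodule ℂ E :=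
  T.comap (LinearMap.prod LinearMap.id (z • LinearMap.id))

/-- The relation `(T - z)⁻¹ = {(f' - z f, f) | (f, f') ∈ T}`. -/
def resolvent (T : Submodule ℂ (E × E)) (z : ℂ) : Submodule ℂ (E × E) :=
  T.map (LinearMap.prod (LinearMap.snd ℂ E E - z • LinearMap.fst ℂ E E) (LinearMap.fst ℂ E E))

/-- The resolvent set: `(T - z)⁻¹` is the graph of an everywhere defined bounded operator. -/
def resolventSet (T : Submodule ℂ (E × E)) : Set ℂ :=
  {z | ∃ R : E →L[ℂ] E, resolvent T z = R.toLinearMap.graph}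

/-- The image `R(L) = {f | (g, f) ∈ R for some g ∈ L}` of a subspace under a relation. -/
def image (R : Submodule ℂ (E × E)) (L : Submodule ℂ E) : Submodule ℂ E :=
  (R ⊓ L.prod ⊤).map (LinearMap.snd ℂ E E)

/-- `T` is minimal with respect to the subspace `L`: the closed linear span of the subspaces
`L + (T - z)⁻¹ L`, `z` in the resolvent set of `T`, is the whole space. -/
def IsMinimalWrt (T : Submodule ℂ (E × E)) (L : Submodule ℂ E) : Prop :=
  (⨆ z ∈ resolventSet T, L ⊔ image (resolvent T z) L).topologicalClosure = ⊤

end Relations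

section Boundary

variable {E G : Type*} [NormedAddCommGroup E] [InnerProductSpace ℂ E]
  [NormedAddCommGroup G] [InnerProductSpace ℂ G]

/-- Green's identity `(f', g) - (f, g') = (h', k) - (h, k')` for `p = {(f, f'), (h, h')}` and
`q = {(g, g'), (k, k')}`. -/
def GreenIdentity (p q : (E × E) × (G × G)) : Prop :=
  inner ℂ q.1.1 p.1.2 - inner ℂ q.1.2 p.1.1 = inner ℂ q.2.1 p.2.2 - inner ℂ q.2.2 p.2.1

/-- The domain of a relation from `E²` to `G²`, a relation in `E`. -/
def dom (Γ : Submodule ℂ ((E × E) × (G × G))) : Submodule ℂ (E × E) :=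
  Γ.map (LinearMap.fst ℂ (E × E) (G × G))

/-- `Γ ⊆ E² × G²` is a boundary relation for `S*`, where `S` is a closed symmetric relation. -/
structure IsBoundaryRelation (S : Submodule ℂ (E × E)) (Γ : Submodule ℂ ((E × E) × (G × G))) :
    Prop where
  isClosed : IsClosed (S : Set (E × E))
  isSymmetric : IsSymmetric S
  dom_le : dom Γ ≤ S.adjoint
  dom_dense : S.adjoint ≤ (dom Γ).topologicalClosure
  green : ∀ p ∈ Γ, ∀ q ∈ Γ, GreenIdentity p q
  maximal : ∀ q : (E × E) × (G × G), (∀ p ∈ Γ, GreenIdentity p q) → q ∈ Γ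

/-- The boundary relation `Γ` with domain `T` is minimal: the eigenspaces `ker (T - z)`, `z` nonreal,
span a dense subspace. -/
def IsMinimal (Γ : Submodule ℂ ((E × E) × (G × G))) : Prop :=
  (⨆ z ∈ {z : ℂ | z.im ≠ 0}, eigenspace (dom Γ) z).topologicalClosure = ⊤

/-- An ordinary boundary triplet `{G, Γ₀, Γ₁}` for `A*`. The boundedness of `Γ₀`, `Γ₁` in the graph
norm and the equality of `dim G` with both defect numbers of `A` are consequences. -/
structure BoundaryTriplet (A : Submodule ℂ (E × E)) (G : Type*) [NormedAddCommGroup G]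
    [InnerProductSpace ℂ G] where
  Γ₀ : A.adjoint →ₗ[ℂ] G
  Γ₁ : A.adjoint →ₗ[ℂ] G
  green : ∀ f g : A.adjoint, GreenIdentity ((f : E × E), (Γ₀ f, Γ₁ f)) ((g : E × E), (Γ₀ g, Γ₁ g))
  surjective : Function.Surjective fun f : A.adjoint => (Γ₀ f, Γ₁ f)

end Boundary

section Coupling

variable {H₁ H₂ G : Type*} [NormedAddCommGroup H₁] [InnerProductSpace ℂ H₁]
  [NormedAddCommGroup H₂] [InnerProductSpace ℂ H₂] [NormedAddCommGroup G] [InnerProductSpace ℂ G]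

/-- `(f₁, f₁') ⊕ (f₂, f₂') = (f₁ ⊕ f₂, f₁' ⊕ f₂')`, a pair of vectors of the Hilbert space
`H₁ ⊕ H₂`. -/
def couple (f₁ : H₁ × H₁) (f₂ : H₂ × H₂) : WithLp 2 (H₁ × H₂) × WithLp 2 (H₁ × H₂) :=
  (WithLp.toLp 2 (f₁.1, f₂.1), WithLp.toLp 2 (f₁.2, f₂.2))

/-- The subspace `H₁` of `H₁ ⊕ H₂`. -/
def firstSummand (H₁ H₂ : Type*) [NormedAddCommGroup H₁] [InnerProductSpace ℂ H₁]
    [NormedAddCommGroup H₂] [InnerProductSpace ℂ H₂] : Submodule ℂ (WithLp 2 (H₁ × H₂)) where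
  carrier := {x | x.snd = 0}
  add_mem' := by intro a b ha hb; simp_all
  zero_mem' := by simp
  smul_mem' := by intro c x hx; simp_all

/-- `B` extends the relation `A` in `H₁`. -/
def Extends (B : Submodule ℂ (WithLp 2 (H₁ × H₂) × WithLp 2 (H₁ × H₂)))
    (A : Submodule ℂ (H₁ × H₁)) : Prop :=
  ∀ f ∈ A, couple f (0 : H₂ × H₂) ∈ B

/-- `S₂ = B ∩ H₂²`, as a relation in `H₂`. -/
def sectionTwo (B : Submodule ℂ (WithLp 2 (H₁ × H₂) × WithLp 2 (H₁ × H₂))) :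
    Submodule ℂ (H₂ × H₂) where
  carrier := {f₂ | couple (0 : H₁ × H₁) f₂ ∈ B}
  add_mem' := by
    intro a b ha hb
    have h := B.add_mem ha hb
    simpa [couple, ← WithLp.toLp_add] using h
  zero_mem' := B.zero_mem
  smul_mem' := by
    intro c x hx
    have h := B.smul_mem c hx
    simpa [couple, ← WithLp.toLp_smul] using h

/-- `T₂ = {(P₂ φ, P₂ φ') | (φ, φ') ∈ B}`. -/
def projectionTwo (B : Submodule ℂ (WithLp 2 (H₁ × H₂) × WithLp 2 (H₁ × H₂))) :
    Submodule ℂ (H₂ × H₂) where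
  carrier := {f₂ | ∃ f₁ : H₁ × H₁, couple f₁ f₂ ∈ B}
  add_mem' := by
    rintro a b ⟨f, hf⟩ ⟨g, hg⟩
    exact ⟨f + g, B.add_mem hf hg⟩
  zero_mem' := ⟨0, B.zero_mem⟩
  smul_mem' := by
    rintro c x ⟨f, hf⟩
    exact ⟨c • f, B.smul_mem c hf⟩

/-- The relation
`χ = {{f₂, (Γ₀ f₁, -Γ₁ f₁)} | f₁ ⊕ f₂ ∈ B, f₁ ∈ A*, f₂ ∈ T₂}` from `H₂²` to `G²`. -/
def inducedRelation {A : Submodule ℂ (H₁ × H₁)} (P : BoundaryTriplet A G)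
    (B : Submodule ℂ (WithLp 2 (H₁ × H₂) × WithLp 2 (H₁ × H₂))) :
    Submodule ℂ ((H₂ × H₂) × (G × G)) where
  carrier := {p | ∃ f₁ : A.adjoint, couple (f₁ : H₁ × H₁) p.1 ∈ B ∧ p.1 ∈ projectionTwo B ∧
    p.2 = (P.Γ₀ f₁, -P.Γ₁ f₁)}
  add_mem' := by
    rintro a b ⟨f, hf, hf', hfa⟩ ⟨g, hg, hg', hgb⟩
    refine ⟨f + g, B.add_mem hf hg, add_mem hf' hg', ?_⟩
    simp [hfa, hgb, add_comm]
  zero_mem' := ⟨0, B.zero_mem, zero_mem _, by simp [← Prod.mk_zero_zero]⟩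
  smul_mem' := by
    rintro c x ⟨f, hf, hf', hfx⟩
    exact ⟨c • f, B.smul_mem c hf, Submodule.smul_mem _ c hf', by simp [hfx]⟩

/-- The coupling `{f₁ ⊕ f₂ ∈ A* ⊕ S₂* | {f₂, (Γ₀ f₁, -Γ₁ f₁)} ∈ χ}`. -/
def coupling {A : Submodule ℂ (H₁ × H₁)} (P : BoundaryTriplet A G) (S₂ : Submodule ℂ (H₂ × H₂))
    (χ : Submodule ℂ ((H₂ × H₂) × (G × G))) :
    Submodule ℂ (WithLp 2 (H₁ × H₂) × WithLp 2 (H₁ × H₂)) where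
  carrier := {φ | ∃ (f₁ : A.adjoint) (f₂ : S₂.adjoint), φ = couple (f₁ : H₁ × H₁) (f₂ : H₂ × H₂) ∧
    ((f₂ : H₂ × H₂), (P.Γ₀ f₁, -P.Γ₁ f₁)) ∈ χ}
  add_mem' := by
    rintro a b ⟨f₁, f₂, rfl, hf⟩ ⟨g₁, g₂, rfl, hg⟩
    refine ⟨f₁ + g₁, f₂ + g₂, rfl, ?_⟩
    have h := χ.add_mem hf hg
    simpa [add_comm] using h
  zero_mem' := ⟨0, 0, rfl, by rw [map_zero, map_zero, neg_zero]; exact χ.zero_mem⟩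
  smul_mem' := by
    rintro c x ⟨f₁, f₂, rfl, hf⟩
    refine ⟨c • f₁, c • f₂, rfl, ?_⟩
    have h := χ.smul_mem c hf
    simpa using h

end Coupling

end LinRel

end

/-! Linear relations in `E` are handled through the boundary form `(f', g) - (f, g')` on `E²`, for
which the adjoint is the orthogonal complement. The boundary form of `H₁ ⊕ H₂` is the sum of the
forms of the summands, and the map `f ↦ (Γ₀ f, -Γ₁ f)` carries the form of `A*` to minus the form of
`G²`, surjectively. Hence a closed relation `B ⊆ A* ⊕ H₂²` that contains `A` and the relation
`χ = {(f₂, (Γ₀ f₁, -Γ₁ f₁)) | f₁ ⊕ f₂ ∈ B}` determine each other, and `B = B*` corresponds to Green's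
identity (`B ⊆ B*`) together with its maximality (`B* ⊆ B`) for `χ`; see
`isBoundaryRelation_inducedRelation` and `isSelfadjoint_coupling`. In both directions
`T₂ = dom χ` is the projection of `B` to `H₂`, and `S₂ = B ∩ H₂²` equals `T₂*`
(`IsSelfadjoint.sectionTwo_eq`), so that `S₂* = T₂**` is the closure of `T₂`.

The two notions of minimality agree by `IsSelfadjoint.isMinimalWrt_iff`. For nonreal `z`, which
always belong to the resolvent set (`IsSelfadjoint.mem_resolventSet`), an element `(f, f')` of `B`
with `f' - z f ∈ H₁` is the same as a lift of a vector of `ker (T₂ - z)`, so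
`P₂ (B - z)⁻¹ H₁ = ker (T₂ - z)`. Real points of the resolvent set contribute nothing new because
the resolvent is continuous there (`snd_mem_closure_eigenspaces`). -/

namespace LinRel

/-! ### Linear relations and the boundary form -/

section Relations

variable {E : Type*} [NormedAddCommGroup E] [InnerProductSpace ℂ E]

/-- The boundary form `(f', g) - (f, g')` of `p = (f, f')` and `q = (g, g')`; it is linear in `p`
and conjugate linear in `q`. -/
noncomputable def boundaryForm (p q : E × E) : ℂ := inner ℂ q.1 p.2 - inner ℂ q.2 p.1

theorem boundaryForm_zero_left (q : E × E) : boundaryForm 0 q = 0 := by simp [boundaryForm]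

theorem boundaryForm_zero_right (p : E × E) : boundaryForm p 0 = 0 := by simp [boundaryForm]

/-- The boundary form is nondegenerate. -/
theorem eq_zero_of_boundaryForm_eq_zero {p : E × E} (h : ∀ q, boundaryForm p q = 0) : p = 0 := by
  have h1 := h (p.2, 0)
  have h2 := h (0, p.1)
  simp only [boundaryForm, inner_zero_left, sub_zero, zero_sub, neg_eq_zero,
    inner_self_eq_zero] at h1 h2
  exact Prod.ext h2 h1

theorem boundaryForm_conj (p q : E × E) :
    (starRingEnd ℂ) (boundaryForm p q) = -boundaryForm q p := by
  simp [boundaryForm, inner_conj_symm]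

theorem boundaryForm_eq_zero_comm {p q : E × E} : boundaryForm p q = 0 ↔ boundaryForm q p = 0 := by
  rw [← neg_eq_zero (a := boundaryForm q p), ← boundaryForm_conj, map_eq_zero]

/-- The adjoint is the orthogonal complement with respect to the boundary form. -/
theorem mem_adjoint_iff_boundaryForm {T : Submodule ℂ (E × E)} {p : E × E} :
    p ∈ T.adjoint ↔ ∀ q ∈ T, boundaryForm p q = 0 := by
  rw [Submodule.mem_adjoint_iff]
  constructor
  · intro h q hq
    rw [boundaryForm, ← neg_sub, h q.1 q.2 hq, neg_zero]
  · intro h a b hab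
    rw [← neg_sub, neg_eq_zero]
    exact h (a, b) hab

theorem isClosed_adjoint (T : Submodule ℂ (E × E)) : IsClosed (T.adjoint : Set (E × E)) := by
  have : (T.adjoint : Set (E × E)) = ⋂ q ∈ T, {p | boundaryForm p q = 0} := by
    ext p
    simp only [SetLike.mem_coe, mem_adjoint_iff_boundaryForm, Set.mem_iInter, Set.mem_ofPred_eq]
  rw [this]
  refine isClosed_biInter fun q _ => isClosed_eq ?_ continuous_const
  unfold boundaryForm
  fun_prop

theorem adjoint_adjoint_le_topologicalClosure [CompleteSpace E] (T : Submodule ℂ (E × E)) :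
    T.adjoint.adjoint ≤ T.topologicalClosure := by
  intro x hx
  -- `T*` is a rotated copy of the orthogonal complement of `T` in the Hilbert space `E ⊕ E`.
  let U := WithLp.prodContinuousLinearEquiv 2 ℂ E E
  let M : Submodule ℂ (WithLp 2 (E × E)) := T.comap U.toLinearEquiv.toLinearMap
  have hxM : WithLp.toLp 2 x ∈ Mᗮᗮ := by
    intro y hy
    have hy' : (y.snd, -y.fst) ∈ T.adjoint := by
      rw [Submodule.mem_adjoint_iff]
      intro a b hab
      have := hy (WithLp.toLp 2 (a, b)) hab
      rw [WithLp.prod_inner_apply] at this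
      simpa [add_comm] using this
    have := (Submodule.mem_adjoint_iff _ _).1 hx _ _ hy'
    rw [WithLp.prod_inner_apply]
    rw [inner_neg_left] at this
    change inner ℂ y.fst x.1 + inner ℂ y.snd x.2 = 0
    linear_combination -this
  rw [Submodule.orthogonal_orthogonal_eq_closure] at hxM
  have hmap : Set.MapsTo U (M : Set _) (T : Set (E × E)) := fun y hy => hy
  exact map_mem_closure U.continuous hxM hmap

theorem mem_orthogonal_biSup {ι : Type*} {p : ι → Prop} {V : ι → Submodule ℂ E} {x : E} :
    x ∈ (⨆ i, ⨆ _ : p i, V i)ᗮ ↔ ∀ i, p i → ∀ y ∈ V i, inner ℂ y x = 0 := by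
  constructor
  · exact fun hx i hi y hy => hx y (le_iSup₂_of_le (f := fun i (_ : p i) => V i) i hi le_rfl hy)
  · intro h y hy
    have : ⨆ i, ⨆ _ : p i, V i ≤ (ℂ ∙ x)ᗮ := iSup₂_le fun i hi v hv =>
      Submodule.mem_orthogonal_singleton_iff_inner_left.2 (h i hi v hv)
    exact Submodule.mem_orthogonal_singleton_iff_inner_left.1 (this hy)

theorem mem_resolvent {T : Submodule ℂ (E × E)} {z : ℂ} {p : E × E} :
    p ∈ resolvent T z ↔ (p.2, p.1 + z • p.2) ∈ T := by
  constructor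
  · rintro ⟨q, hq, rfl⟩
    simpa using hq
  · intro h
    exact ⟨_, h, by simp⟩

theorem mem_image_resolvent {T : Submodule ℂ (E × E)} {z : ℂ} {L : Submodule ℂ E} {f : E} :
    f ∈ image (resolvent T z) L ↔ ∃ h ∈ L, (f, h + z • f) ∈ T := by
  constructor
  · rintro ⟨⟨h, f⟩, ⟨hp, hL, -⟩, rfl⟩
    exact ⟨h, hL, mem_resolvent.1 hp⟩
  · rintro ⟨h, hL, hf⟩
    exact ⟨(h, f), ⟨mem_resolvent.2 hf, hL, trivial⟩, rfl⟩

/-- The imaginary part of `(f' - z f, f)` is `-(Im z) ‖f‖²` on a symmetric relation. -/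
theorem IsSymmetric.abs_im_mul_norm_le {T : Submodule ℂ (E × E)} (hT : IsSymmetric T) (z : ℂ)
    {p : E × E} (hp : p ∈ T) : |z.im| * ‖p.1‖ ≤ ‖p.2 - z • p.1‖ := by
  have h0 : boundaryForm p p = 0 := mem_adjoint_iff_boundaryForm.1 (hT hp) p hp
  have him : (inner ℂ p.1 p.2).im = 0 := by
    rw [boundaryForm, ← inner_conj_symm p.2 p.1, sub_eq_zero] at h0
    exact Complex.conj_eq_iff_im.1 h0.symm
  have h1 : (inner ℂ p.1 (p.2 - z • p.1)).im = -z.im * ‖p.1‖ ^ 2 := by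
    have hre : inner ℂ p.1 p.1 = ((‖p.1‖ ^ 2 : ℝ) : ℂ) := by
      rw [inner_self_eq_norm_sq_to_K]
      norm_cast
    rw [inner_sub_right, inner_smul_right, hre, Complex.sub_im, him, Complex.im_mul_ofReal]
    ring
  have h2 : |z.im| * ‖p.1‖ ^ 2 ≤ ‖p.1‖ * ‖p.2 - z • p.1‖ := by
    calc |z.im| * ‖p.1‖ ^ 2 = |(inner ℂ p.1 (p.2 - z • p.1)).im| := by
          rw [h1, abs_mul, abs_neg, abs_of_nonneg (sq_nonneg ‖p.1‖)]
      _ ≤ ‖inner ℂ p.1 (p.2 - z • p.1)‖ := Complex.abs_im_le_norm _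
      _ ≤ _ := norm_inner_le_norm _ _
  rcases (norm_nonneg p.1).eq_or_lt with h | h
  · rw [← h, mul_zero]
    exact norm_nonneg _
  · refine le_of_mul_le_mul_left ?_ h
    linarith

/-- Every nonreal number belongs to the resolvent set of a selfadjoint relation `T`: the map
`(f, f') ↦ f' - z f` from `T` is bounded below, so its range is closed, and a vector orthogonal to
the range lies in `ker (T - z̄) = 0`. -/
theorem IsSelfadjoint.mem_resolventSet [CompleteSpace E] {T : Submodule ℂ (E × E)}
    (hT : IsSelfadjoint T) {z : ℂ} (hz : z.im ≠ 0) : z ∈ resolventSet T := by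
  have hs : IsSymmetric T := hT.ge
  have hc : IsClosed (T : Set (E × E)) := hT ▸ isClosed_adjoint T
  have : CompleteSpace T := hc.completeSpace_coe
  have hz' : 0 < |z.im| := abs_pos.2 hz
  let D : T →L[ℂ] E :=
    (ContinuousLinearMap.snd ℂ E E - z • ContinuousLinearMap.fst ℂ E E).comp T.subtypeL
  have hD : ∀ p : T, D p = (p : E × E).2 - z • (p : E × E).1 := fun p => rfl
  have hfst : ∀ p : T, ‖(p : E × E).1‖ ≤ |z.im|⁻¹ * ‖D p‖ := by
    intro p
    rw [inv_mul_eq_div, le_div_iff₀ hz', mul_comm]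
    exact hs.abs_im_mul_norm_le z p.2
  let C : NNReal := ⟨|z.im|⁻¹ + (1 + ‖z‖ * |z.im|⁻¹), by positivity⟩
  have hanti : AntilipschitzWith C D := by
    refine AddMonoidHomClass.antilipschitz_of_bound D ?_
    intro p
    change ‖(p : E × E)‖ ≤ (|z.im|⁻¹ + (1 + ‖z‖ * |z.im|⁻¹)) * ‖D p‖
    have h1 := hfst p
    have h2 : ‖(p : E × E).2‖ ≤ ‖D p‖ + ‖z‖ * ‖(p : E × E).1‖ := by
      calc ‖(p : E × E).2‖ = ‖D p + z • (p : E × E).1‖ := by rw [hD, sub_add_cancel]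
        _ ≤ _ := (norm_add_le _ _).trans_eq (by rw [norm_smul])
    have h3 : ‖z‖ * ‖(p : E × E).1‖ ≤ ‖z‖ * (|z.im|⁻¹ * ‖D p‖) := by gcongr
    have h4 : 0 ≤ |z.im|⁻¹ * ‖D p‖ := by positivity
    have h5 : 0 ≤ ‖z‖ * (|z.im|⁻¹ * ‖D p‖) := by positivity
    have h6 := norm_nonneg (D p)
    rw [Prod.norm_def, max_le_iff]
    constructor <;> nlinarith
  have hclosed : IsClosed (D.range : Set E) := by
    exact hanti.isClosed_range D.uniformContinuous
  have hrange : D.range = ⊤ := by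
    have : CompleteSpace D.range := hclosed.completeSpace_coe
    rw [← Submodule.orthogonal_eq_bot_iff, Submodule.eq_bot_iff]
    intro g hg
    -- Orthogonality of `g` to all `f' - z f` says that `(g, z̄ g)` belongs to `T* = T`.
    have hmem : (g, (starRingEnd ℂ z) • g) ∈ T := by
      refine hT.le (mem_adjoint_iff_boundaryForm.2 fun q hq => ?_)
      have := hg (D ⟨q, hq⟩) ⟨_, rfl⟩
      rw [hD, inner_sub_left, inner_smul_left] at this
      rw [boundaryForm, inner_smul_right]
      linear_combination -this
    have hb := hs.abs_im_mul_norm_le (starRingEnd ℂ z) hmem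
    rw [sub_self, norm_zero, Complex.conj_im, abs_neg] at hb
    have : ‖g‖ ≤ 0 := by
      by_contra! h
      exact absurd hb (not_le.2 (mul_pos hz' h))
    exact norm_le_zero_iff.1 this
  let e : T ≃ₗ[ℂ] E := LinearEquiv.ofBijective D.toLinearMap
    ⟨hanti.injective, LinearMap.range_eq_top.1 hrange⟩
  have he : ∀ p, e p = D p := fun p => rfl
  let R : E →L[ℂ] E :=
    ((LinearMap.fst ℂ E E).comp (T.subtype.comp e.symm.toLinearMap)).mkContinuous (|z.im|⁻¹) (by
      intro h
      have := hfst (e.symm h)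
      rwa [← he, e.apply_symm_apply] at this)
  have hR : ∀ h, R h = (e.symm h : E × E).1 := fun h => rfl
  refine ⟨R, ?_⟩
  ext ⟨h, f⟩
  rw [mem_resolvent, LinearMap.mem_graph_iff]
  change _ ↔ f = R h
  rw [hR]
  constructor
  · intro hf
    have : e ⟨_, hf⟩ = h := by rw [he, hD]; simp
    rw [← this, e.symm_apply_apply]
  · rintro rfl
    have h1 : (e.symm h : E × E).2 - z • (e.symm h : E × E).1 = h := by
      rw [← hD, ← he, e.apply_symm_apply]
    rw [← eq_add_of_sub_eq h1]
    exact (e.symm h).2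

end Relations

/-! ### The two relations induced in the second summand -/

section Coupling

theorem exists_couple {H₁ H₂ : Type*} (φ : WithLp 2 (H₁ × H₂) × WithLp 2 (H₁ × H₂)) :
    ∃ f₁ f₂, φ = couple f₁ f₂ :=
  ⟨(φ.1.fst, φ.2.fst), (φ.1.snd, φ.2.snd), rfl⟩

variable {H₁ H₂ G : Type*} [NormedAddCommGroup H₁] [InnerProductSpace ℂ H₁]
  [NormedAddCommGroup H₂] [InnerProductSpace ℂ H₂] [NormedAddCommGroup G] [InnerProductSpace ℂ G]

theorem boundaryForm_couple (f₁ g₁ : H₁ × H₁) (f₂ g₂ : H₂ × H₂) :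
    boundaryForm (couple f₁ f₂) (couple g₁ g₂) = boundaryForm f₁ g₁ + boundaryForm f₂ g₂ := by
  simp only [boundaryForm, couple, WithLp.prod_inner_apply]
  ring

variable {B : Submodule ℂ (WithLp 2 (H₁ × H₂) × WithLp 2 (H₁ × H₂))}

/-- `S₂ = T₂*` for the two relations that a selfadjoint relation induces in `H₂`. -/
theorem IsSelfadjoint.sectionTwo_eq (hB : IsSelfadjoint B) :
    sectionTwo B = (projectionTwo B).adjoint := by
  ext f₂
  change couple (0 : H₁ × H₁) f₂ ∈ B ↔ _
  have hB' : couple (0 : H₁ × H₁) f₂ ∈ B ↔ couple (0 : H₁ × H₁) f₂ ∈ B.adjoint :=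
    ⟨fun h => hB.ge h, fun h => hB.le h⟩
  rw [hB', mem_adjoint_iff_boundaryForm, mem_adjoint_iff_boundaryForm]
  constructor
  · rintro h g₂ ⟨g₁, hg⟩
    have := h _ hg
    rwa [boundaryForm_couple, boundaryForm_zero_left, zero_add] at this
  · intro h φ hφ
    obtain ⟨g₁, g₂, rfl⟩ := exists_couple φ
    rw [boundaryForm_couple, boundaryForm_zero_left, zero_add]
    exact h g₂ ⟨g₁, hφ⟩

theorem mem_eigenspace_projectionTwo {z : ℂ} {x : H₂} :
    x ∈ eigenspace (projectionTwo B) z ↔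
      ∃ φ h : WithLp 2 (H₁ × H₂), h ∈ firstSummand H₁ H₂ ∧ (φ, h + z • φ) ∈ B ∧ φ.snd = x := by
  constructor
  · rintro ⟨f₁, hf⟩
    refine ⟨WithLp.toLp 2 (f₁.1, x), WithLp.toLp 2 (f₁.2 - z • f₁.1, 0), rfl, ?_, rfl⟩
    convert hf using 1
    simp [couple, ← WithLp.toLp_smul, ← WithLp.toLp_add]
  · rintro ⟨φ, h, hh, hB, rfl⟩
    refine ⟨(φ.fst, (h + z • φ).fst), ?_⟩
    convert hB using 1
    have hh' : h.snd = 0 := hh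
    have : (h + z • φ).snd = z • φ.snd := by simp [hh']
    change (φ, WithLp.toLp 2 ((h + z • φ).fst, z • φ.snd)) = _
    rw [← this]
    rfl

/-- At every point `z` of the resolvent set, `P₂ (B - z)⁻¹ H₁` lies in the closed span of the
eigenspaces of `T₂` at nonreal points. Only real `z` need an argument: there the resolvents at
`z + i t` converge to the one at `z` as `t → 0`. -/
theorem snd_mem_closure_eigenspaces [CompleteSpace H₁] [CompleteSpace H₂] {z : ℂ}
    (hz : z ∈ resolventSet B) {φ h : WithLp 2 (H₁ × H₂)} (hh : h ∈ firstSummand H₁ H₂)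
    (hφ : (φ, h + z • φ) ∈ B) :
    φ.snd ∈ (⨆ w ∈ {w : ℂ | w.im ≠ 0}, eigenspace (projectionTwo B) w).topologicalClosure := by
  set M := ⨆ w ∈ {w : ℂ | w.im ≠ 0}, eigenspace (projectionTwo B) w
  have hM : ∀ w : ℂ, w.im ≠ 0 → eigenspace (projectionTwo B) w ≤ M := fun w hw =>
    le_iSup₂_of_le w hw le_rfl
  by_cases hzim : z.im = 0
  swap
  · exact M.le_topologicalClosure (hM z hzim (mem_eigenspace_projectionTwo.2 ⟨φ, h, hh, hφ, rfl⟩))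
  obtain ⟨R, hR⟩ := hz
  have hRφ : φ = R h := by
    have : (h, φ) ∈ resolvent B z := mem_resolvent.2 hφ
    rwa [hR] at this
  let u : ℝ → (WithLp 2 (H₁ × H₂) →L[ℂ] WithLp 2 (H₁ × H₂)) := fun t => 1 - ((t : ℂ) * Complex.I) • R
  have hu : Continuous u := by fun_prop
  have hu0 : u 0 = ((1 : (WithLp 2 (H₁ × H₂) →L[ℂ] WithLp 2 (H₁ × H₂))ˣ) :
      WithLp 2 (H₁ × H₂) →L[ℂ] WithLp 2 (H₁ × H₂)) := by simp [u]
  -- `(1 - i t R)⁻¹ φ` is the value at `h` of the resolvent at `z + i t`.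
  have hlim : Filter.Tendsto (fun t => (Ring.inverse (u t) φ).snd) (nhdsWithin 0 {0}ᶜ)
      (nhds φ.snd) := by
    have h1 : ContinuousAt (fun t => Ring.inverse (u t)) 0 := by
      refine ContinuousAt.comp (g := Ring.inverse) ?_ hu.continuousAt
      rw [hu0]
      exact NormedRing.inverse_continuousAt 1
    have h2 : ContinuousAt (fun t => (Ring.inverse (u t) φ).snd) 0 :=
      (WithLp.continuous_snd 2 H₁ H₂).continuousAt.comp (h1.clm_apply continuousAt_const)
    have h3 := h2.tendsto
    rw [hu0, Ring.inverse_unit, inv_one, Units.val_one] at h3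
    exact h3.mono_left nhdsWithin_le_nhds
  refine mem_closure_of_tendsto hlim ?_
  have hunit : ∀ᶠ t in nhds (0 : ℝ), IsUnit (u t) := by
    refine hu.continuousAt.eventually (Units.isOpen.mem_nhds ?_)
    rw [hu0]
    exact Units.isUnit 1
  filter_upwards [nhdsWithin_le_nhds hunit, self_mem_nhdsWithin] with t ht ht0
  refine hM (z + t * Complex.I) (by simpa [hzim] using ht0) ?_
  set ψ := Ring.inverse (u t) φ with hψ
  have hψ1 : u t ψ = φ := by
    have := Ring.mul_inverse_cancel _ ht
    rw [hψ, ← mul_apply_eq_comp, this, one_apply_eq_self]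
  have hψ2 : ψ = R (h + ((t : ℂ) * Complex.I) • ψ) := by
    rw [map_add, ← hRφ, map_smul]
    exact (eq_add_of_sub_eq hψ1)
  have hψ3 : (h + ((t : ℂ) * Complex.I) • ψ, ψ) ∈ resolvent B z := by
    rw [hR]
    exact hψ2
  refine mem_eigenspace_projectionTwo.2 ⟨ψ, h, hh, ?_, rfl⟩
  convert mem_resolvent.1 hψ3 using 2
  simp only [add_smul]
  abel

/-- Minimality of a selfadjoint relation with respect to `H₁` amounts to density of the span of the
eigenspaces of `T₂` in `H₂`. -/
theorem IsSelfadjoint.isMinimalWrt_iff [CompleteSpace H₁] [CompleteSpace H₂]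
    (hB : IsSelfadjoint B) :
    IsMinimalWrt B (firstSummand H₁ H₂) ↔
      (⨆ z ∈ {z : ℂ | z.im ≠ 0}, eigenspace (projectionTwo B) z).topologicalClosure = ⊤ := by
  rw [IsMinimalWrt, Submodule.topologicalClosure_eq_top_iff, Submodule.eq_bot_iff]
  constructor
  · intro hmin
    rw [Submodule.topologicalClosure_eq_top_iff, Submodule.eq_bot_iff]
    intro x hx
    have hx0 : (WithLp.toLp 2 ((0 : H₁), x)) = 0 := by
      refine hmin _ ?_
      refine mem_orthogonal_biSup.2 fun z hz y hy => ?_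
      obtain ⟨a, ha, b, hb, rfl⟩ := Submodule.mem_sup.1 hy
      have ha' : a.snd = 0 := ha
      obtain ⟨h, hh, hb⟩ := mem_image_resolvent.1 hb
      rw [← Submodule.orthogonal_closure] at hx
      have := hx _ (snd_mem_closure_eigenspaces hz hh hb)
      simpa [WithLp.prod_inner_apply, ha'] using this
    exact congrArg WithLp.snd hx0
  · intro hmin x hx
    rw [Submodule.topologicalClosure_eq_top_iff, Submodule.eq_bot_iff] at hmin
    rw [mem_orthogonal_biSup] at hx
    have hx1 : x.fst = 0 := by
      have hI : Complex.I ∈ resolventSet B := hB.mem_resolventSet (by simp)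
      have := hx Complex.I hI (WithLp.toLp 2 (x.fst, 0)) (Submodule.mem_sup_left rfl)
      simpa [WithLp.prod_inner_apply] using this
    have hx2 : x.snd = 0 := by
      refine hmin _ (mem_orthogonal_biSup.2 fun z hz y hy => ?_)
      obtain ⟨φ, h, hh, hφ, rfl⟩ := mem_eigenspace_projectionTwo.1 hy
      have := hx z (hB.mem_resolventSet hz) φ
        (Submodule.mem_sup_right (mem_image_resolvent.2 ⟨h, hh, hφ⟩))
      simpa [WithLp.prod_inner_apply, hx1] using this
    exact congrArg (WithLp.toLp 2) (Prod.ext hx1 hx2)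

theorem greenIdentity_iff {E : Type*} [NormedAddCommGroup E] [InnerProductSpace ℂ E]
    {p q : (E × E) × (G × G)} :
    GreenIdentity p q ↔ boundaryForm p.1 q.1 = boundaryForm p.2 q.2 := Iff.rfl

/-! ### Boundary values of the triplet -/

variable {A : Submodule ℂ (H₁ × H₁)} (P : BoundaryTriplet A G)

/-- The boundary values `(Γ₀ f, -Γ₁ f)`: the sign turns Green's identity for the triplet into
`boundaryForm f g + boundaryForm (Γ₀ f, -Γ₁ f) (Γ₀ g, -Γ₁ g) = 0`. -/
theorem BoundaryTriplet.boundaryForm_eq (f g : A.adjoint) :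
    boundaryForm (f : H₁ × H₁) (g : H₁ × H₁) =
      -boundaryForm (P.Γ₀ f, -P.Γ₁ f) (P.Γ₀ g, -P.Γ₁ g) := by
  rw [greenIdentity_iff.1 (P.green f g)]
  simp only [boundaryForm, inner_neg_right, inner_neg_left]
  ring

theorem BoundaryTriplet.exists_eq (h : G × G) :
    ∃ f : A.adjoint, (P.Γ₀ f, -P.Γ₁ f) = h := by
  obtain ⟨f, hf⟩ := P.surjective (h.1, -h.2)
  rw [Prod.mk.injEq] at hf
  exact ⟨f, Prod.ext hf.1 (by rw [hf.2, neg_neg])⟩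

/-- The boundary mappings vanish on `A`. -/
theorem BoundaryTriplet.eq_zero_of_mem {f : A.adjoint} (hf : (f : H₁ × H₁) ∈ A) :
    (P.Γ₀ f, -P.Γ₁ f) = 0 := by
  refine eq_zero_of_boundaryForm_eq_zero fun k => ?_
  obtain ⟨g, rfl⟩ := P.exists_eq k
  rw [← neg_eq_zero, ← P.boundaryForm_eq, boundaryForm_eq_zero_comm]
  exact mem_adjoint_iff_boundaryForm.1 g.2 _ hf

/-! ### The boundary relation induced by a selfadjoint extension -/

/-- The first component of an element of a selfadjoint extension of `A` is automatically in
`A*`. -/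
theorem fst_mem_adjoint (hB : IsSelfadjoint B) (hext : Extends B A) {f₁ : H₁ × H₁}
    {f₂ : H₂ × H₂} (hf : couple f₁ f₂ ∈ B) : f₁ ∈ A.adjoint := by
  rw [mem_adjoint_iff_boundaryForm]
  intro a ha
  have := mem_adjoint_iff_boundaryForm.1 (hB.ge hf) _ (hext a ha)
  rwa [boundaryForm_couple, boundaryForm_zero_right, add_zero] at this

theorem dom_inducedRelation (hB : IsSelfadjoint B) (hext : Extends B A) :
    dom (inducedRelation P B) = projectionTwo B := by
  ext f₂
  constructor
  · rintro ⟨p, ⟨f₁, hf, hp, -⟩, rfl⟩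
    exact hp
  · rintro ⟨f₁, hf⟩
    exact ⟨(f₂, _), ⟨⟨f₁, fst_mem_adjoint hB hext hf⟩, hf, ⟨f₁, hf⟩, rfl⟩, rfl⟩

/-- A selfadjoint `B` is its own complement for the sum of the boundary forms of `H₁` and `H₂`.
On `A*` the triplet transports the first form, up to sign, to `G`, onto all of `G²`, so Green's
identity and its maximality for the induced relation say `B ⊆ B*` and `B* ⊆ B`. -/
theorem isBoundaryRelation_inducedRelation [CompleteSpace H₂] (hB : IsSelfadjoint B)
    (hext : Extends B A) : IsBoundaryRelation (sectionTwo B) (inducedRelation P B) := by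
  have hle : sectionTwo B ≤ projectionTwo B := fun f₂ hf => ⟨0, hf⟩
  have hsym : projectionTwo B ≤ (sectionTwo B).adjoint := by
    intro f₂ hf
    rw [hB.sectionTwo_eq, mem_adjoint_iff_boundaryForm]
    intro g₂ hg
    exact boundaryForm_eq_zero_comm.1 (mem_adjoint_iff_boundaryForm.1 hg _ hf)
  refine ⟨hB.sectionTwo_eq ▸ isClosed_adjoint _, hle.trans hsym, ?_, ?_, ?_, ?_⟩
  · rwa [dom_inducedRelation P hB hext]
  · rw [dom_inducedRelation P hB hext, hB.sectionTwo_eq]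
    exact adjoint_adjoint_le_topologicalClosure _
  · rintro p ⟨f₁, hf, -, hp⟩ q ⟨g₁, hg, -, hq⟩
    have := mem_adjoint_iff_boundaryForm.1 (hB.ge hf) _ hg
    rw [boundaryForm_couple, P.boundaryForm_eq, ← hp, ← hq] at this
    rw [greenIdentity_iff]
    linear_combination this
  · intro q hq
    -- Lift the boundary data of `q` to `A*`; the resulting coupled pair lies in `B* = B`.
    obtain ⟨g₁, hg₁⟩ := P.exists_eq q.2
    have hmem : couple (g₁ : H₁ × H₁) q.1 ∈ B := by
      refine hB.le (mem_adjoint_iff_boundaryForm.2 fun φ hφ => ?_)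
      obtain ⟨f₁, f₂, rfl⟩ := exists_couple φ
      have hf₁ := fst_mem_adjoint hB hext hφ
      have := greenIdentity_iff.1
        (hq (f₂, (P.Γ₀ ⟨f₁, hf₁⟩, -P.Γ₁ ⟨f₁, hf₁⟩)) ⟨⟨f₁, hf₁⟩, hφ, ⟨f₁, hφ⟩, rfl⟩)
      have h2 := P.boundaryForm_eq ⟨f₁, hf₁⟩ g₁
      rw [boundaryForm_eq_zero_comm, boundaryForm_couple]
      rw [hg₁] at h2
      linear_combination this + h2
    exact ⟨g₁, hmem, ⟨g₁, hmem⟩, hg₁.symm⟩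

/-! ### The coupling of a boundary triplet and a boundary relation -/

variable {S₂ : Submodule ℂ (H₂ × H₂)} {χ : Submodule ℂ ((H₂ × H₂) × (G × G))}

theorem IsBoundaryRelation.fst_mem_adjoint (hχ : IsBoundaryRelation S₂ χ)
    {p : (H₂ × H₂) × (G × G)} (hp : p ∈ χ) : p.1 ∈ S₂.adjoint := hχ.dom_le ⟨p, hp, rfl⟩

theorem extends_coupling (hA : IsSymmetric A) : Extends (coupling P S₂ χ) A := by
  intro f hf
  refine ⟨⟨f, hA hf⟩, 0, rfl, ?_⟩
  rw [P.eq_zero_of_mem (f := ⟨f, hA hf⟩) hf]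
  exact χ.zero_mem

theorem isSelfadjoint_coupling (hA : IsSymmetric A) (hχ : IsBoundaryRelation S₂ χ) :
    IsSelfadjoint (coupling P S₂ χ) := by
  refine le_antisymm ?_ ?_
  · intro φ hφ
    obtain ⟨g₁, g₂, rfl⟩ := exists_couple φ
    rw [mem_adjoint_iff_boundaryForm] at hφ
    have hg₁ : g₁ ∈ A.adjoint := by
      refine mem_adjoint_iff_boundaryForm.2 fun a ha => ?_
      have := hφ _ (extends_coupling (S₂ := S₂) (χ := χ) P hA a ha)
      rwa [boundaryForm_couple, boundaryForm_zero_right, add_zero] at this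
    -- An element of the adjoint of the coupling satisfies Green's identity against all of `χ`,
    -- because every boundary value in `G²` is attained on `A*`.
    have hmem : (g₂, (P.Γ₀ ⟨g₁, hg₁⟩, -P.Γ₁ ⟨g₁, hg₁⟩)) ∈ χ := by
      refine hχ.maximal _ fun p hp => ?_
      obtain ⟨f₁, hf₁⟩ := P.exists_eq p.2
      have hc : couple (f₁ : H₁ × H₁) p.1 ∈ coupling P S₂ χ :=
        ⟨f₁, ⟨p.1, hχ.fst_mem_adjoint hp⟩, rfl, by rw [hf₁]; exact hp⟩
      have h1 := boundaryForm_eq_zero_comm.1 (hφ _ hc)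
      have h2 := P.boundaryForm_eq f₁ ⟨g₁, hg₁⟩
      rw [boundaryForm_couple, h2, hf₁] at h1
      rw [greenIdentity_iff]
      linear_combination h1
    exact ⟨⟨g₁, hg₁⟩, ⟨g₂, hχ.fst_mem_adjoint hmem⟩, rfl, hmem⟩
  · rintro φ ⟨f₁, f₂, rfl, hf⟩
    rw [mem_adjoint_iff_boundaryForm]
    rintro ψ ⟨g₁, g₂, rfl, hg⟩
    have := greenIdentity_iff.1 (hχ.green _ hf _ hg)
    rw [boundaryForm_couple, P.boundaryForm_eq]
    linear_combination this

theorem projectionTwo_coupling (hχ : IsBoundaryRelation S₂ χ) :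
    projectionTwo (coupling P S₂ χ) = dom χ := by
  ext f₂
  constructor
  · rintro ⟨f₁, g₁, g₂, h, hg⟩
    have : f₂ = g₂ := Prod.ext (congrArg (fun φ => φ.1.snd) h) (congrArg (fun φ => φ.2.snd) h)
    exact ⟨_, hg, this.symm⟩
  · rintro ⟨p, hp, rfl⟩
    obtain ⟨f₁, hf₁⟩ := P.exists_eq p.2
    exact ⟨f₁, f₁, ⟨p.1, hχ.fst_mem_adjoint hp⟩, rfl, by rw [hf₁]; exact hp⟩

/-- A boundary relation for `S₂*` recovers `S₂` as the adjoint of its domain. -/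
theorem IsBoundaryRelation.adjoint_dom [CompleteSpace H₂] (hχ : IsBoundaryRelation S₂ χ) :
    (dom χ).adjoint = S₂ := by
  refine le_antisymm ?_ ?_
  · have h : (dom χ).adjoint ≤ S₂.adjoint.adjoint := by
      intro f hf
      rw [mem_adjoint_iff_boundaryForm] at hf ⊢
      intro g hg
      have hcl : IsClosed {q : H₂ × H₂ | boundaryForm f q = 0} := by
        refine isClosed_eq ?_ continuous_const
        unfold boundaryForm
        fun_prop
      exact closure_minimal (s := (dom χ : Set (H₂ × H₂))) hf hcl (hχ.dom_dense hg)
    refine h.trans ((adjoint_adjoint_le_topologicalClosure S₂).trans ?_)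
    exact S₂.topologicalClosure_minimal le_rfl hχ.isClosed
  · intro f hf
    refine mem_adjoint_iff_boundaryForm.2 fun g hg => ?_
    exact boundaryForm_eq_zero_comm.1 (mem_adjoint_iff_boundaryForm.1 (hχ.dom_le hg) f hf)

end Coupling

end LinRel

theorem theorem6p3
    {H₁ H₂ G : Type*}
    [NormedAddCommGroup H₁] [InnerProductSpace ℂ H₁] [CompleteSpace H₁]
    [NormedAddCommGroup H₂] [InnerProductSpace ℂ H₂] [CompleteSpace H₂]
    [NormedAddCommGroup G] [InnerProductSpace ℂ G] [CompleteSpace G]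
    (A : Submodule ℂ (H₁ × H₁)) (hA : LinRel.IsSymmetric A)
    (P : LinRel.BoundaryTriplet A G) :
    (∀ B : Submodule ℂ (WithLp 2 (H₁ × H₂) × WithLp 2 (H₁ × H₂)),
      LinRel.IsSelfadjoint B → LinRel.Extends B A →
      LinRel.IsMinimalWrt B (LinRel.firstSummand H₁ H₂) →
        LinRel.IsBoundaryRelation (LinRel.sectionTwo B) (LinRel.inducedRelation P B) ∧
        LinRel.IsMinimal (LinRel.inducedRelation P B)) ∧
    (∀ (S₂ : Submodule ℂ (H₂ × H₂)) (χ : Submodule ℂ ((H₂ × H₂) × (G × G))),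
      LinRel.IsSimple S₂ → LinRel.IsBoundaryRelation S₂ χ → LinRel.IsMinimal χ →
        LinRel.IsSelfadjoint (LinRel.coupling P S₂ χ) ∧
        LinRel.Extends (LinRel.coupling P S₂ χ) A ∧
        LinRel.IsMinimalWrt (LinRel.coupling P S₂ χ) (LinRel.firstSummand H₁ H₂) ∧
        LinRel.sectionTwo (LinRel.coupling P S₂ χ) = S₂) := by
  refine ⟨fun B hB hext hmin => ⟨LinRel.isBoundaryRelation_inducedRelation P hB hext, ?_⟩,
    fun S₂ χ _ hχ hmin => ?_⟩
  · rw [LinRel.IsMinimal, LinRel.dom_inducedRelation P hB hext]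
    exact hB.isMinimalWrt_iff.1 hmin
  · have hB := LinRel.isSelfadjoint_coupling P hA hχ
    refine ⟨hB, LinRel.extends_coupling P hA, hB.isMinimalWrt_iff.2 ?_, ?_⟩
    · rwa [LinRel.projectionTwo_coupling P hχ]
    · rw [hB.sectionTwo_eq, LinRel.projectionTwo_coupling P hχ, hχ.adjoint_dom]
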